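/- Let $F$ be a field of characteristic $0$; algebras and superalgebras over $F$ are not assumed associative or unital. For a superalgebra $A=A_0\oplus A_1$ (a $\mathbb Z_2$-graded $F$-algebra) let $G(A)=G_0\otimes A_0+G_1\otimes A_1$ be its Grassmann envelope, where $G=G_0\oplus G_1$ is the Grassmann algebra on countably many generators. For a multilinear nonassociative polynomial $f$, the superalgebra $A$ is said to satisfy the superidentity $\tilde f=0$ if the algebra $G(A)$ satisfies the identity $f=0$. The supervariety generated by $A$ is the class of all superalgebras over $F$ that satisfy every superidentity $\tilde f=0$ ($f$ multilinear) satisfied by $A$. Let $\mathfrak M$ be the variety of all metabelian algebras over $F$, that is, of all algebras with the identity $(xy)(zt)=0$; an $\mathfrak M$-superalgebra is a superalgebra whose Grassmann envelope lies in $\mathfrak M$, equivalently a superalgebra satisfying $(xy)(zt)=0$. For nonnegative integers $r,s$ let $\mathfrak M_{r,s}$ be the supervariety generated by the free $\mathfrak M$-superalgebra on $r$ even and $s$ odd generators (for $r=s=0$ this free superalgebra is $0$ and $\mathfrak M_{0,0}$ consists of the zero superalgebras). Theorem. Let $r,s,r',s'$ be nonnegative integers. If $\mathfrak M_{r',s'}\subseteq\mathfrak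 M_{r,s}$, then $r'\le r$ and $s'\le s$. If $\mathfrak M_{r',s'}=\mathfrak M_{r,s}$, then $r'=r$ and $s'=s$. -/

import Mathlib

open scoped TensorProduct

noncomputable section

namespace Superrank

universe u

/-! ### Superalgebras and Grassmann envelopes -/

/-- A (not necessarily associative or unital) superalgebra over `F`: an `F`-algebra with a
`ℤ/2`-grading `A = A₀ ⊕ A₁`, `Aᵢ Aⱼ ⊆ Aᵢ₊ⱼ`. -/
structure Superalgebra (F : Type u) [Field F] where
  carrier : Type u
  [ring : NonUnitalNonAssocRing carrier]
  [module : Module F carrier]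
  [isScalarTower : IsScalarTower F carrier carrier]
  [smulCommClass : SMulCommClass F carrier carrier]
  /-- `part 0` is the even part, `part 1` is the odd part. -/
  part : ZMod 2 → Submodule F carrier
  isInternal : DirectSum.IsInternal part
  mul_mem : ∀ (i j : ZMod 2) (a b : carrier), a ∈ part i → b ∈ part j → a * b ∈ part (i + j)

attribute [instance] Superalgebra.ring Superalgebra.module Superalgebra.isScalarTower
  Superalgebra.smulCommClass

/-- The (unital) Grassmann algebra on the countably many generators
`e₀, e₁, …` (the standard basis vectors of `ℕ →₀ F`). -/
abbrev Grassmann (F : Type u) [Field F] : Type u := ExteriorAlgebra F (ℕ →₀ F)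

/-- The even (`i = 0`) and the odd (`i = 1`) part of the Grassmann algebra: the span of the words
in the generators whose length is congruent to `i` modulo `2`. -/
abbrev grassmannPart (F : Type u) [Field F] (i : ZMod 2) : Submodule F (Grassmann F) :=
  CliffordAlgebra.evenOdd (0 : QuadraticForm F (ℕ →₀ F)) i

/-- The Grassmann envelope `G(A) = G₀ ⊗ A₀ + G₁ ⊗ A₁`, a subalgebra of `G ⊗ A`. -/
def Superalgebra.envelope {F : Type u} [Field F] (A : Superalgebra F) :
    NonUnitalSubalgebra F (Grassmann F ⊗[F] A.carrier) where
  toSubmodule := Submodule.span F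
    {t | ∃ (i : ZMod 2) (g : Grassmann F) (a : A.carrier),
      g ∈ grassmannPart F i ∧ a ∈ A.part i ∧ t = g ⊗ₜ[F] a}
  mul_mem' := by
    intro x y hx hy
    change x ∈ Submodule.span F _ at hx
    change y ∈ Submodule.span F _ at hy
    change x * y ∈ Submodule.span F _
    induction hx using Submodule.span_induction with
    | zero => rw [zero_mul]; exact Submodule.zero_mem _
    | add a b _ _ ha hb => rw [add_mul]; exact Submodule.add_mem _ ha hb
    | smul c a _ ha => rw [smul_mul_assoc]; exact Submodule.smul_mem _ _ ha
    | mem a ha =>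
      induction hy using Submodule.span_induction with
      | zero => rw [mul_zero]; exact Submodule.zero_mem _
      | add c d _ _ hc hd => rw [mul_add]; exact Submodule.add_mem _ hc hd
      | smul c d _ hd => rw [mul_smul_comm]; exact Submodule.smul_mem _ _ hd
      | mem b hb =>
        obtain ⟨i, g, a, hg, ha, rfl⟩ := ha
        obtain ⟨j, h, b, hh, hb, rfl⟩ := hb
        refine Submodule.subset_span ⟨i + j, g * h, a * b, ?_, A.mul_mem i j a b ha hb, ?_⟩
        · exact SetLike.mul_mem_graded hg hh
        · exact Algebra.TensorProduct.tmul_mul_tmul g h a b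

/-! ### Multilinear identities and superidentities -/

/-- The number of occurrences of the variable `i` in a nonassociative word. -/
def varCount {n : ℕ} (i : Fin n) : FreeMagma (Fin n) → ℕ
  | .of j => if j = i then 1 else 0
  | .mul v w => varCount i v + varCount i w

/-- A nonassociative polynomial in the variables `x₀, …, xₙ₋₁` is multilinear if every variable
occurs exactly once in each of its monomials. -/
def IsMultilinear {F : Type u} [Field F] {n : ℕ}
    (f : FreeNonUnitalNonAssocAlgebra F (Fin n)) : Prop :=
  ∀ w : FreeMagma (Fin n), f.coeff w ≠ 0 → ∀ i : Fin n, varCount i w = 1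

/-- The algebra `B` satisfies the identity `f = 0`. -/
def SatisfiesIdentity {F : Type u} [Field F] (B : Type*) [NonUnitalNonAssocRing B] [Module F B]
    [IsScalarTower F B B] [SMulCommClass F B B] {n : ℕ}
    (f : FreeNonUnitalNonAssocAlgebra F (Fin n)) : Prop :=
  ∀ x : Fin n → B, FreeNonUnitalNonAssocAlgebra.lift F x f = 0

/-- The superalgebra `A` satisfies the superidentity `f̃ = 0` corresponding to the multilinear
identity `f = 0`, that is, the Grassmann envelope of `A` satisfies `f = 0`. -/
def Superalgebra.SatisfiesSuperidentity {F : Type u} [Field F] (A : Superalgebra F) {n : ℕ}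
    (f : FreeNonUnitalNonAssocAlgebra F (Fin n)) : Prop :=
  SatisfiesIdentity (F := F) A.envelope f

/-- The supervariety generated by the superalgebra `A`: the class of all superalgebras that
satisfy every superidentity (corresponding to a multilinear polynomial) of `A`. -/
def supervarietyGeneratedBy {F : Type u} [Field F] (A : Superalgebra F) :
    Set (Superalgebra F) :=
  {B | ∀ (n : ℕ) (f : FreeNonUnitalNonAssocAlgebra F (Fin n)), IsMultilinear f →
    A.SatisfiesSuperidentity f → B.SatisfiesSuperidentity f}

/-! ### Free metabelian superalgebras -/

section Free

variable (F : Type u) [Field F] (X : Type)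

/-- The ideal of the free nonassociative algebra on `X` generated by all products
`(ab)(cd)`. -/
def metabelianIdeal : Submodule F (FreeNonUnitalNonAssocAlgebra F X) :=
  sInf {I | (∀ a b c d, (a * b) * (c * d) ∈ I) ∧ ∀ x, ∀ y ∈ I, x * y ∈ I ∧ y * x ∈ I}

variable {F X} in
theorem metabelianIdeal_base (a b c d : FreeNonUnitalNonAssocAlgebra F X) :
    (a * b) * (c * d) ∈ metabelianIdeal F X :=
  Submodule.mem_sInf.2 fun _ hI => hI.1 a b c d

variable {F X} in
theorem metabelianIdeal_mul_left (x : FreeNonUnitalNonAssocAlgebra F X)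
    {y : FreeNonUnitalNonAssocAlgebra F X} (hy : y ∈ metabelianIdeal F X) :
    x * y ∈ metabelianIdeal F X :=
  Submodule.mem_sInf.2 fun I hI => (hI.2 x y (Submodule.mem_sInf.1 hy I hI)).1

variable {F X} in
theorem metabelianIdeal_mul_right (x : FreeNonUnitalNonAssocAlgebra F X)
    {y : FreeNonUnitalNonAssocAlgebra F X} (hy : y ∈ metabelianIdeal F X) :
    y * x ∈ metabelianIdeal F X :=
  Submodule.mem_sInf.2 fun I hI => (hI.2 x y (Submodule.mem_sInf.1 hy I hI)).2

/-- The free metabelian algebra on `X`: the quotient of the free nonassociative algebra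
by the ideal generated by all products `(ab)(cd)`. -/
def FreeMetabelian : Type u := FreeNonUnitalNonAssocAlgebra F X ⧸ metabelianIdeal F X

namespace FreeMetabelian

instance : AddCommGroup (FreeMetabelian F X) :=
  inferInstanceAs (AddCommGroup (FreeNonUnitalNonAssocAlgebra F X ⧸ metabelianIdeal F X))

instance : Module F (FreeMetabelian F X) :=
  inferInstanceAs (Module F (FreeNonUnitalNonAssocAlgebra F X ⧸ metabelianIdeal F X))

/-- The quotient map. -/
def mk : FreeNonUnitalNonAssocAlgebra F X →ₗ[F] FreeMetabelian F X := (metabelianIdeal F X).mkQ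

variable {F X}

theorem mk_surjective : Function.Surjective (mk F X) := Submodule.mkQ_surjective _

theorem mk_eq_mk {a b : FreeNonUnitalNonAssocAlgebra F X} :
    mk F X a = mk F X b ↔ a - b ∈ metabelianIdeal F X :=
  Submodule.Quotient.eq _

/-- Multiplication of classes, `[a] [b] = [a b]`. -/
instance : Mul (FreeMetabelian F X) where
  mul := Quotient.map₂ (· * ·) <| by
    intro a a' ha b b' hb
    have ha : a - a' ∈ metabelianIdeal F X := (Submodule.quotientRel_def _).1 ha
    have hb : b - b' ∈ metabelianIdeal F X := (Submodule.quotientRel_def _).1 hb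
    refine (Submodule.quotientRel_def _).2 ?_
    have h : a * b - a' * b' = (a - a') * b + a' * (b - b') := by
      rw [sub_mul, mul_sub]; abel
    change a * b - a' * b' ∈ _
    rw [h]
    exact Submodule.add_mem _ (metabelianIdeal_mul_right _ ha) (metabelianIdeal_mul_left _ hb)

theorem mk_mul (a b : FreeNonUnitalNonAssocAlgebra F X) :
    mk F X (a * b) = mk F X a * mk F X b := rfl

instance : NonUnitalNonAssocRing (FreeMetabelian F X) where
  left_distrib x y z := by
    obtain ⟨a, rfl⟩ := mk_surjective x
    obtain ⟨b, rfl⟩ := mk_surjective y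
    obtain ⟨c, rfl⟩ := mk_surjective z
    rw [← map_add, ← mk_mul, ← mk_mul, ← mk_mul, mul_add, map_add]
  right_distrib x y z := by
    obtain ⟨a, rfl⟩ := mk_surjective x
    obtain ⟨b, rfl⟩ := mk_surjective y
    obtain ⟨c, rfl⟩ := mk_surjective z
    rw [← map_add, ← mk_mul, ← mk_mul, ← mk_mul, add_mul, map_add]
  zero_mul x := by
    obtain ⟨a, rfl⟩ := mk_surjective x
    rw [← map_zero (mk F X), ← mk_mul, zero_mul]
  mul_zero x := by
    obtain ⟨a, rfl⟩ := mk_surjective x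
    rw [← map_zero (mk F X), ← mk_mul, mul_zero]

instance : IsScalarTower F (FreeMetabelian F X) (FreeMetabelian F X) where
  smul_assoc c x y := by
    obtain ⟨a, rfl⟩ := mk_surjective x
    obtain ⟨b, rfl⟩ := mk_surjective y
    rw [smul_eq_mul, smul_eq_mul, ← map_smul, ← mk_mul, ← mk_mul, ← map_smul, smul_mul_assoc]

instance : SMulCommClass F (FreeMetabelian F X) (FreeMetabelian F X) where
  smul_comm c x y := by
    obtain ⟨a, rfl⟩ := mk_surjective x
    obtain ⟨b, rfl⟩ := mk_surjective y
    rw [smul_eq_mul, smul_eq_mul, ← map_smul, ← mk_mul, ← mk_mul, ← map_smul, mul_smul_comm]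

/-- The parity of a nonassociative word in generators of prescribed parities `p`. -/
def wordParity (p : X → ZMod 2) : FreeMagma X → ZMod 2
  | .of x => p x
  | .mul v w => wordParity p v + wordParity p w

variable (F) in
/-- The `i`-th component of the free metabelian algebra on generators of parities `p`:
the span of (the classes of) all words of parity `i`. -/
def part (p : X → ZMod 2) (i : ZMod 2) : Submodule F (FreeMetabelian F X) :=
  Submodule.span F {t | ∃ w : FreeMagma X, wordParity p w = i ∧
    t = mk F X (MonoidAlgebra.ofMagma F (FreeMagma X) w)}

theorem part_mul_mem (p : X → ZMod 2) (i j : ZMod 2) (a b : FreeMetabelian F X)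
    (ha : a ∈ part F p i) (hb : b ∈ part F p j) : a * b ∈ part F p (i + j) := by
  induction ha using Submodule.span_induction with
  | zero => rw [zero_mul]; exact Submodule.zero_mem _
  | add a b _ _ ha hb => rw [add_mul]; exact Submodule.add_mem _ ha hb
  | smul c a _ ha => rw [smul_mul_assoc]; exact Submodule.smul_mem _ _ ha
  | mem a ha =>
    induction hb using Submodule.span_induction with
    | zero => rw [mul_zero]; exact Submodule.zero_mem _
    | add c d _ _ hc hd => rw [mul_add]; exact Submodule.add_mem _ hc hd
    | smul c d _ hd => rw [mul_smul_comm]; exact Submodule.smul_mem _ _ hd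
    | mem b hb =>
      obtain ⟨v, hv, rfl⟩ := ha
      obtain ⟨w, hw, rfl⟩ := hb
      refine Submodule.subset_span ⟨v * w, ?_, ?_⟩
      · rw [← hv, ← hw]; rfl
      · rw [map_mul, mk_mul]

/-- The sign `(-1)^i`. -/
def sgn (F : Type u) [Field F] (i : ZMod 2) : F := if i = 0 then 1 else -1

theorem zmod_two_cases : ∀ i : ZMod 2, i = 0 ∨ i = 1 := by decide

theorem sgn_add (i j : ZMod 2) : sgn F (i + j) = sgn F i * sgn F j := by
  rcases zmod_two_cases i with rfl | rfl <;> rcases zmod_two_cases j with rfl | rfl <;>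
    simp [sgn, show (1 : ZMod 2) + 1 = 0 from rfl]

/-- The free metabelian algebra is metabelian. -/
theorem mul_mul_mul_eq_zero (a b c d : FreeMetabelian F X) : (a * b) * (c * d) = 0 := by
  obtain ⟨a, rfl⟩ := mk_surjective a
  obtain ⟨b, rfl⟩ := mk_surjective b
  obtain ⟨c, rfl⟩ := mk_surjective c
  obtain ⟨d, rfl⟩ := mk_surjective d
  rw [← mk_mul, ← mk_mul, ← mk_mul, ← map_zero (mk F X), mk_eq_mk, sub_zero]
  exact metabelianIdeal_base a b c d

/-- The universal property of the free metabelian algebra. -/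
def lift {B : Type*} [NonUnitalNonAssocRing B] [Module F B] [IsScalarTower F B B]
    [SMulCommClass F B B] (hB : ∀ a b c d : B, (a * b) * (c * d) = 0) (φ : X → B) :
    FreeMetabelian F X →ₙₐ[F] B :=
  let ψ : FreeMetabelian F X →ₗ[F] B :=
    (metabelianIdeal F X).liftQ
      (FreeNonUnitalNonAssocAlgebra.lift F φ : FreeNonUnitalNonAssocAlgebra F X →ₗ[F] B) <| by
        refine sInf_le ⟨fun a b c d => ?_, fun x y hy => ?_⟩
        · change FreeNonUnitalNonAssocAlgebra.lift F φ _ = 0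
          rw [map_mul, map_mul, map_mul]
          exact hB _ _ _ _
        · have hy : FreeNonUnitalNonAssocAlgebra.lift F φ y = 0 := hy
          constructor
          · change FreeNonUnitalNonAssocAlgebra.lift F φ _ = 0
            rw [map_mul, hy, mul_zero]
          · change FreeNonUnitalNonAssocAlgebra.lift F φ _ = 0
            rw [map_mul, hy, zero_mul]
  { ψ with
    map_zero' := ψ.map_zero
    map_mul' := by
      intro x y
      obtain ⟨a, rfl⟩ := mk_surjective x
      obtain ⟨b, rfl⟩ := mk_surjective y
      exact map_mul (FreeNonUnitalNonAssocAlgebra.lift F φ) a b }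

theorem lift_mk {B : Type*} [NonUnitalNonAssocRing B] [Module F B] [IsScalarTower F B B]
    [SMulCommClass F B B] (hB : ∀ a b c d : B, (a * b) * (c * d) = 0) (φ : X → B)
    (a : FreeNonUnitalNonAssocAlgebra F X) :
    lift hB φ (mk F X a) = FreeNonUnitalNonAssocAlgebra.lift F φ a := rfl

/-- The automorphism `x ↦ (-1)^{p(x)} x` of the free metabelian algebra acts on the `i`-th
component as `(-1)^i`. -/
theorem exists_parity (p : X → ZMod 2) :
    ∃ θ : FreeMetabelian F X →ₙₐ[F] FreeMetabelian F X,
      ∀ i, ∀ a ∈ part F p i, θ a = sgn F i • a := by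
  let θ : FreeMetabelian F X →ₙₐ[F] FreeMetabelian F X :=
    lift mul_mul_mul_eq_zero fun x => sgn F (p x) • mk F X (FreeNonUnitalNonAssocAlgebra.of F x)
  have hw : ∀ w : FreeMagma X, θ (mk F X (MonoidAlgebra.ofMagma F (FreeMagma X) w)) =
      sgn F (wordParity p w) • mk F X (MonoidAlgebra.ofMagma F (FreeMagma X) w) := by
    intro w
    induction w using FreeMagma.recOnMul with
    | ih1 x => exact FreeNonUnitalNonAssocAlgebra.lift_of_apply _ _ _
    | ih2 v w hv hw =>
      rw [map_mul, mk_mul, map_mul, hv, hw, smul_mul_smul_comm, ← sgn_add]; rfl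
  refine ⟨θ, fun i a ha => ?_⟩
  induction ha using Submodule.span_induction with
  | zero => rw [map_zero, smul_zero]
  | add a b _ _ ha hb => rw [map_add, ha, hb, smul_add]
  | smul c a _ ha => rw [map_smul, ha, smul_comm]
  | mem a ha =>
    obtain ⟨w, rfl, rfl⟩ := ha
    exact hw w

theorem part_sup (p : X → ZMod 2) : part F p 0 ⊔ part F p 1 = ⊤ := by
  rw [eq_top_iff]
  rintro a -
  obtain ⟨a, rfl⟩ := mk_surjective a
  induction a using MonoidAlgebra.induction_linear with
  | zero => rw [map_zero]; exact Submodule.zero_mem _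
  | add a b ha hb => rw [map_add]; exact Submodule.add_mem _ ha hb
  | single w c =>
    have h : (MonoidAlgebra.single w c : FreeNonUnitalNonAssocAlgebra F X) =
        c • MonoidAlgebra.ofMagma F (FreeMagma X) w := by
      simp [MonoidAlgebra.ofMagma]
    rw [h, map_smul]
    refine Submodule.smul_mem _ _ ?_
    rcases zmod_two_cases (wordParity p w) with hw | hw
    · exact Submodule.mem_sup_left (Submodule.subset_span ⟨w, hw, rfl⟩)
    · exact Submodule.mem_sup_right (Submodule.subset_span ⟨w, hw, rfl⟩)

theorem part_isInternal [CharZero F] (p : X → ZMod 2) : DirectSum.IsInternal (part F p) := by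
  have huniv : (Set.univ : Set (ZMod 2)) = {0, 1} := by
    ext i; simpa using zmod_two_cases i
  rw [DirectSum.isInternal_submodule_iff_isCompl _ (zero_ne_one) huniv]
  refine ⟨?_, codisjoint_iff.2 (part_sup p)⟩
  rw [Submodule.disjoint_def]
  intro a h0 h1
  obtain ⟨θ, hθ⟩ := exists_parity (F := F) p
  have e0 := hθ 0 a h0
  have e1 := hθ 1 a h1
  simp only [sgn, if_true, one_smul, one_ne_zero, if_false, neg_smul] at e0 e1
  have h : (2 : F) • a = 0 := by
    rw [two_smul]; nth_rewrite 1 [← e0]; rw [e1, neg_add_cancel]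
  exact (smul_eq_zero.1 h).resolve_left two_ne_zero

end FreeMetabelian

end Free

/-- The free metabelian superalgebra on `r` even and `s` odd generators. The superidentity
corresponding to `(xy)(zt) = 0` is `(xy)(zt) = 0` itself, so this is the free superalgebra among
those whose Grassmann envelope is a metabelian algebra. -/
def freeMetabelianSuperalgebra (F : Type u) [Field F] [CharZero F] (r s : ℕ) :
    Superalgebra F where
  carrier := FreeMetabelian F (Fin r ⊕ Fin s)
  part := FreeMetabelian.part F (Sum.elim (fun _ => 0) (fun _ => 1))
  isInternal := FreeMetabelian.part_isInternal _
  mul_mem := FreeMetabelian.part_mul_mem _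

/-- The supervariety `𝔐_{r,s}` generated by the free metabelian superalgebra on `r` even and `s`
odd generators. For `r = s = 0` the generating superalgebra is zero, so that `𝔐_{0,0}` consists
of the zero superalgebras. -/
def metabelianSupervariety (F : Type u) [Field F] [CharZero F] (r s : ℕ) :
    Set (Superalgebra F) :=
  supervarietyGeneratedBy (freeMetabelianSuperalgebra F r s)

end Superrank

end

noncomputable section

namespace Superrank

universe u

/-! ### Exchange of factors and doubly symmetrized products -/

section Exchange

open Equiv

variable {T : Type*} [Ring T] {m k : ℕ}

/-! The supervarieties are separated by explicit multilinear polynomials `rectPolynomial ε m k`.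
Fill an `m × k` rectangle with variables, multiply the corresponding left multiplications block by
block, `ε`-symmetrize over each row (fixed second index, `m` entries), `-ε`-symmetrize over each
block (fixed first index, `k` entries), and apply the result to a product of two further variables.

In the Grassmann envelope, two elements `g ⊗ x`, `h ⊗ x` over the same generator `x` may be
interchanged in any product of left multiplications, with sign `+` for even `x` and `-` for odd `x`.
A letter that is itself a product kills the word by metabelianity, so only generators matter. Take
`ε = 1`, `k = r + 1`, `m = (r + 1) * s + 1`. A row containing an odd generator twice vanishes, so
each row has at most `s` odd entries and all rows together have fewer than `m`. Hence some block
contains only even generators; having `r + 1` places it repeats one, and its skew symmetrization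
vanishes. This is `doubleSym_eq_zero_of_labels`, a superanalogue of the hook argument. The case `ε =
-1` exchanges the roles of `r` and `s`.

If there are at least `k` generators of parity sign `ε`, put the `i`-th one in the whole `i`-th row.
Row symmetrization then only multiplies by a nonzero integer, while the block permutations yield
pairwise distinct words, which are linearly independent in the free metabelian algebra
(`exists_word_coeff`). So the polynomial does not vanish (`tensorAction_doubleSym_ne_zero`). -/

/-- The elements `a` and `b` may be interchanged in every product, at the cost of the sign `ε`. -/
def Exchange (ε : ℤˣ) (a b : T) : Prop := ∀ u : T, a * u * b = (ε : ℤ) • (b * u * a)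

theorem units_int_mul_self (ε : ℤˣ) : (ε : ℤ) * (ε : ℤ) = 1 := by
  rw [← Units.val_mul, Int.units_mul_self, Units.val_one]

theorem Exchange.symm {ε : ℤˣ} {a b : T} (h : Exchange ε a b) : Exchange ε b a := fun u => by
  rw [h u, smul_smul, units_int_mul_self, one_smul]

/-- The product of the values of `X`, in the order prescribed by `π` and the lexicographic
order. -/
def wordAt (π : Perm (Fin m × Fin k)) (X : Fin m × Fin k → T) : T :=
  (List.ofFn fun j => X (π (finProdFinEquiv.symm j))).prod

/-- The letter `X p` occurs in every word and is followed either by another letter or, in the last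
place, by `Y`; hence the two hypotheses. -/
theorem wordAt_eq_zero_of_mul_eq_zero (π : Perm (Fin m × Fin k)) (X : Fin m × Fin k → T) (Y : T)
    (p : Fin m × Fin k)
    (hX : ∀ q, X p * X q = 0) (hY : X p * Y = 0) : wordAt π X * Y = 0 := by
  have key : ∀ l : List (Fin m × Fin k), p ∈ l → (l.map X).prod * Y = 0 := by
    intro l hl
    obtain ⟨l₁, l₂, rfl⟩ := List.append_of_mem hl
    rw [List.map_append, List.prod_append, List.map_cons, List.prod_cons, mul_assoc]
    cases l₂ with
    | nil => simp [hY]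
    | cons q l₂ =>
      rw [List.map_cons, List.prod_cons, ← mul_assoc (X p), hX, zero_mul, zero_mul, mul_zero]
  have := key (List.ofFn fun j => π (finProdFinEquiv.symm j))
    (List.mem_ofFn.2 ⟨finProdFinEquiv (π.symm p), by simp⟩)
  rwa [List.map_ofFn] at this

theorem prod_map_swap_of_split {ι : Type*} [DecidableEq ι] {ε : ℤˣ} {X : ι → T} {p q : ι}
    (hX : Exchange ε (X p) (X q)) {l₁ l₂ l₃ : List ι}
    (hl : (l₁ ++ p :: (l₂ ++ q :: l₃)).Nodup) :
    ((l₁ ++ p :: (l₂ ++ q :: l₃)).map fun i => X (swap p q i)).prod =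
      (ε : ℤ) • ((l₁ ++ p :: (l₂ ++ q :: l₃)).map X).prod := by
  have hcongr : ∀ l : List ι, p ∉ l → q ∉ l → (l.map fun i => X (swap p q i)) = l.map X := by
    intro l hp hq
    refine List.map_congr_left fun i hi => ?_
    rw [swap_apply_of_ne_of_ne (ne_of_mem_of_not_mem hi hp) (ne_of_mem_of_not_mem hi hq)]
  simp only [List.nodup_append, List.nodup_cons, List.mem_append, List.mem_cons, not_or] at hl
  have h₁ := hcongr l₁ (fun h => hl.2.2 p h p (Or.inl rfl) rfl)
    (fun h => hl.2.2 q h q (Or.inr (Or.inr (Or.inl rfl))) rfl)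
  have h₂ := hcongr l₂ hl.2.1.1.1 (fun h => hl.2.1.2.2.2 q h q (Or.inl rfl) rfl)
  have h₃ := hcongr l₃ hl.2.1.1.2.2 hl.2.1.2.2.1.1
  simp only [List.map_append, List.map_cons, List.prod_append, List.prod_cons, h₁, h₂, h₃,
    swap_apply_left, swap_apply_right]
  have h := hX.symm (l₂.map X).prod
  calc _ = (l₁.map X).prod * (X q * (l₂.map X).prod * X p) * (l₃.map X).prod := by
        simp only [mul_assoc]
    _ = _ := by rw [h]; simp only [mul_assoc, mul_smul_comm, smul_mul_assoc]

theorem prod_map_swap {ι : Type*} [DecidableEq ι] {ε : ℤˣ} {X : ι → T} {p q : ι} (hpq : p ≠ q)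
    (hX : Exchange ε (X p) (X q)) {l : List ι} (hl : l.Nodup) (hp : p ∈ l) (hq : q ∈ l) :
    (l.map fun i => X (swap p q i)).prod = (ε : ℤ) • (l.map X).prod := by
  obtain ⟨l₁, l₂, rfl⟩ := List.append_of_mem hp
  rcases List.mem_append.1 hq with hq | hq
  · obtain ⟨l₃, l₄, rfl⟩ := List.append_of_mem hq
    rw [List.append_assoc, List.cons_append] at hl ⊢
    rw [swap_comm]
    exact prod_map_swap_of_split hX.symm hl
  · obtain ⟨l₃, l₄, rfl⟩ := List.append_of_mem ((List.mem_cons.1 hq).resolve_left hpq.symm)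
    exact prod_map_swap_of_split hX hl

/-- Multiplying by the transposition on the left interchanges two letters wherever `ρ` has placed
them. They need not be adjacent, because `Exchange` allows an arbitrary middle factor. -/
theorem wordAt_swap_mul {ε : ℤˣ} {X : Fin m × Fin k → T} {p q : Fin m × Fin k} (hpq : p ≠ q)
    (hX : Exchange ε (X p) (X q)) (ρ : Perm (Fin m × Fin k)) :
    wordAt (swap p q * ρ) X = (ε : ℤ) • wordAt ρ X := by
  have hmem : ∀ i, i ∈ List.ofFn fun j => ρ (finProdFinEquiv.symm j) := fun i =>
    List.mem_ofFn.2 ⟨finProdFinEquiv (ρ.symm i), by simp⟩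
  have := prod_map_swap hpq hX
    (l := List.ofFn fun j => ρ (finProdFinEquiv.symm j))
    (List.nodup_ofFn.2 (ρ.injective.comp finProdFinEquiv.symm.injective)) (hmem p) (hmem q)
  rwa [List.map_ofFn, List.map_ofFn] at this

/-- The trivial character of a symmetric group for `ε = 1`, the sign for `ε = -1`. -/
def signChar (ε : ℤˣ) (α : Type*) [DecidableEq α] [Fintype α] : Perm α →* ℤˣ :=
  if ε = 1 then 1 else Perm.sign

theorem signChar_swap (ε : ℤˣ) {α : Type*} [DecidableEq α] [Fintype α] {p q : α} (h : p ≠ q) :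
    signChar ε α (swap p q) = ε := by
  rcases Int.units_eq_one_or ε with rfl | rfl
  · simp [signChar]
  · simp [signChar, Perm.sign_swap h]

/-- Permutation of the first coordinate, depending on the second one. -/
def rowPerm : (Fin k → Perm (Fin m)) →* Perm (Fin m × Fin k) where
  toFun σ := prodCongrLeft σ
  map_one' := rfl
  map_mul' _ _ := rfl

/-- Permutation of the second coordinate, depending on the first one. -/
def blockPerm : (Fin m → Perm (Fin k)) →* Perm (Fin m × Fin k) where
  toFun τ := prodCongrRight τ
  map_one' := rfl
  map_mul' _ _ := rfl

theorem rowPerm_apply (σ : Fin k → Perm (Fin m)) (p : Fin m × Fin k) :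
    rowPerm σ p = (σ p.2 p.1, p.2) := rfl

theorem blockPerm_apply (τ : Fin m → Perm (Fin k)) (p : Fin m × Fin k) :
    blockPerm τ p = (p.1, τ p.1 p.2) := rfl

theorem rowPerm_mulSingle_swap (i : Fin k) (c d : Fin m) :
    rowPerm (Pi.mulSingle i (swap c d)) = swap (c, i) (d, i) := by
  ext1 ⟨a, j⟩
  rw [rowPerm_apply]
  by_cases hj : j = i
  · subst hj
    simp only [Pi.mulSingle_eq_same, swap_apply_def, Prod.mk.injEq, and_true]
    split_ifs <;> rfl
  · simp [swap_apply_def, hj]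

theorem blockPerm_mulSingle_swap (c : Fin m) (i j : Fin k) :
    blockPerm (Pi.mulSingle c (swap i j)) = swap (c, i) (c, j) := by
  ext1 ⟨a, l⟩
  rw [blockPerm_apply]
  by_cases ha : a = c
  · subst ha
    simp only [Pi.mulSingle_eq_same, swap_apply_def, Prod.mk.injEq, true_and]
    split_ifs <;> rfl
  · simp [swap_apply_def, ha]

/-- Symmetrizing with the sign opposite to the exchange sign gives zero: translation by `s`
multiplies the character by `-ε` and the word by `ε`, so the sum equals its own negative. -/
theorem sum_wordAt_eq_zero [IsAddTorsionFree T] {H : Type*} [Group H] [Fintype H]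
    (j : H →* Perm (Fin m × Fin k)) {ε : ℤˣ} {X : Fin m × Fin k → T} {p q : Fin m × Fin k}
    (hpq : p ≠ q) (hX : Exchange ε (X p) (X q)) (s : H) (hs : j s = swap p q)
    (ρ : Perm (Fin m × Fin k)) :
    ∑ h, (signChar (-ε) _ (j h) : ℤ) • wordAt (j h * ρ) X = 0 := by
  rw [← self_eq_neg, ← Finset.sum_neg_distrib]
  refine Fintype.sum_equiv (Equiv.mulLeft s⁻¹) _ _ fun h => ?_
  obtain ⟨g, rfl⟩ : ∃ g, h = s * g := ⟨s⁻¹ * h, by simp⟩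
  simp only [Equiv.coe_mulLeft, inv_mul_cancel_left]
  rw [map_mul, map_mul, hs, signChar_swap _ hpq,
    mul_assoc, wordAt_swap_mul hpq hX, smul_smul, ← neg_smul]
  congr 1
  push_cast
  linear_combination (-(signChar (-ε) _ (j g) : ℤ)) * units_int_mul_self ε

theorem wordAt_rowPerm_mul {ε : ℤˣ} {X : Fin m × Fin k → T}
    (hX : ∀ i c d, Exchange ε (X (c, i)) (X (d, i))) (σ : Fin k → Perm (Fin m)) :
    ∀ ρ, wordAt (rowPerm σ * ρ) X = (signChar ε _ (rowPerm σ) : ℤ) • wordAt ρ X := by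
  -- The asserted equality is stable under products in `σ`, so it is enough to check a single
  -- transposition in a single row.
  let S : Submonoid (Fin k → Perm (Fin m)) :=
    { carrier := {σ | ∀ ρ, wordAt (rowPerm σ * ρ) X =
        (signChar ε _ (rowPerm σ) : ℤ) • wordAt ρ X}
      mul_mem' := fun {σ τ} hσ hτ ρ => by
        rw [map_mul, mul_assoc, hσ, hτ, smul_smul, map_mul, Units.val_mul]
      one_mem' := fun ρ => by
        rw [map_one, map_one, Units.val_one, one_smul, one_mul] }
  refine Submonoid.pi_mem_of_mulSingle_mem (H := S) σ fun i => ?_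
  induction σ i using Perm.swap_induction_on with
  | one => rw [Pi.mulSingle_one]; exact S.one_mem
  | swap_mul π c d hcd ih =>
    rw [Pi.mulSingle_mul]
    refine S.mul_mem (fun ρ => ?_) ih
    have hne : ((c, i) : Fin m × Fin k) ≠ (d, i) := fun h => hcd (Prod.mk.inj h).1
    rw [rowPerm_mulSingle_swap, wordAt_swap_mul hne (hX i c d), signChar_swap _ hne]

/-- The product of the values of `X`, `ε`-symmetrized in every row `{(c, i) | c}` and
`-ε`-symmetrized in the places of every block `{(c, i) | i}`. -/
def doubleSym (ε : ℤˣ) (X : Fin m × Fin k → T) : T :=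
  ∑ σ : Fin k → Perm (Fin m), ∑ τ : Fin m → Perm (Fin k),
    (signChar ε _ (rowPerm σ) : ℤ) • (signChar (-ε) _ (blockPerm τ) : ℤ) •
      wordAt (rowPerm σ * blockPerm τ) X

theorem doubleSym_eq_zero_of_row [IsAddTorsionFree T] {ε : ℤˣ} {X : Fin m × Fin k → T}
    {i : Fin k} {c d : Fin m} (hcd : c ≠ d) (hX : Exchange (-ε) (X (c, i)) (X (d, i))) :
    doubleSym ε X = 0 := by
  rw [doubleSym, Finset.sum_comm]
  refine Finset.sum_eq_zero fun τ _ => ?_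
  have := sum_wordAt_eq_zero rowPerm (fun h => hcd (Prod.mk.inj h).1) hX
    (Pi.mulSingle i (swap c d)) (rowPerm_mulSingle_swap i c d) (blockPerm τ)
  rw [neg_neg] at this
  simp_rw [smul_comm _ (signChar (-ε) _ (blockPerm τ) : ℤ)]
  rw [← Finset.smul_sum, this, smul_zero]

/-- Each `σ` is treated separately: after the rows are permuted by `σ`, block `c` contains the
letters `X (σ i c, i)`, and two of them with exchange sign `ε` annihilate the sum over `τ`. -/
theorem doubleSym_eq_zero_of_block [IsAddTorsionFree T] {ε : ℤˣ} {X : Fin m × Fin k → T}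
    (hX : ∀ σ : Fin k → Perm (Fin m), ∃ c, ∃ i j, i ≠ j ∧
      Exchange ε (X (σ i c, i)) (X (σ j c, j))) :
    doubleSym ε X = 0 := by
  refine Finset.sum_eq_zero fun σ _ => ?_
  obtain ⟨c, i, j, hij, h⟩ := hX σ
  have := sum_wordAt_eq_zero blockPerm (X := X ∘ rowPerm σ) (p := (c, i)) (q := (c, j))
    (fun h => hij (Prod.mk.inj h).2) h
    (Pi.mulSingle c (swap i j)) (blockPerm_mulSingle_swap c i j) 1
  rw [← Finset.smul_sum]
  simp_rw [mul_one] at this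
  exact (congrArg _ this).trans (smul_zero _)

/-- When every row already has the symmetry imposed on it, the character of `σ` appears twice and
cancels. -/
theorem doubleSym_eq_nsmul {ε : ℤˣ} {X : Fin m × Fin k → T}
    (hX : ∀ i c d, Exchange ε (X (c, i)) (X (d, i))) :
    doubleSym ε X = Fintype.card (Fin k → Perm (Fin m)) •
      ∑ τ : Fin m → Perm (Fin k), (signChar (-ε) _ (blockPerm τ) : ℤ) •
        wordAt (blockPerm τ) X := by
  rw [doubleSym, ← Finset.card_univ, ← Finset.sum_const]
  refine Finset.sum_congr rfl fun σ _ => Finset.sum_congr rfl fun τ _ => ?_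
  rw [wordAt_rowPerm_mul hX, smul_comm, smul_smul, smul_smul, mul_assoc, units_int_mul_self,
    mul_one]

/-- Vanishing of `doubleSym` on elements with few labels: two elements with the same label of
parity `ε` (of parity `-ε`) may be interchanged with the sign `ε` (the sign `-ε`). -/
theorem doubleSym_eq_zero_of_labels [IsAddTorsionFree T] {ε : ℤˣ} {X : Fin m × Fin k → T}
    {L : Type*} [Fintype L] (par : L → ℤˣ) (lab : Fin m × Fin k → L)
    (hX : ∀ p q, lab p = lab q → Exchange (par (lab p)) (X p) (X q))
    (hk : Fintype.card {l // par l = ε} < k)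
    (hm : k * Fintype.card {l // par l = -ε} < m) : doubleSym ε X = 0 := by
  classical
  have hpar : ∀ l, par l ≠ ε → par l = -ε := by
    intro l
    rcases Int.units_eq_one_or (par l) with h | h <;>
    rcases Int.units_eq_one_or ε with rfl | rfl <;> simp [h]
  by_cases hrow : ∃ i c d, c ≠ d ∧ lab (c, i) = lab (d, i) ∧ par (lab (c, i)) = -ε
  · obtain ⟨i, c, d, hcd, hl, hp⟩ := hrow
    exact doubleSym_eq_zero_of_row hcd (hp ▸ hX _ _ hl)
  push Not at hrow
  refine doubleSym_eq_zero_of_block fun σ => ?_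
  -- Otherwise every block `c` has a place `i c` with a label of parity `-ε`. Since no row repeats
  -- such a label, the pair (place, label) determines `c`, contradicting `hm`.
  obtain ⟨c, hc⟩ : ∃ c, ∀ i, par (lab (σ i c, i)) = ε := by
    by_contra! h
    choose i hi using h
    refine hm.not_ge ?_
    have := Fintype.card_le_of_injective
      (fun c : Fin m => ((i c, ⟨lab (σ (i c) c, i c), hpar _ (hi c)⟩) :
        Fin k × {l // par l = -ε})) ?_
    · simpa using this
    intro c d h
    simp only [Prod.mk.injEq, Subtype.mk.injEq] at h
    by_contra hcd
    refine hrow (i c) (σ (i c) c) (σ (i c) d) (fun h' => hcd ((σ (i c)).injective h')) ?_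
      (hpar _ (hi c))
    rw [h.2, h.1]
  -- The `k` places of this block carry fewer than `k` possible labels, so one repeats.
  obtain ⟨i, j, hij, h⟩ := Fintype.exists_ne_map_eq_of_card_lt
    (fun i : Fin k => (⟨lab (σ i c, i), hc i⟩ : {l // par l = ε})) (by simpa using hk)
  refine ⟨c, i, j, hij, ?_⟩
  have := hX _ _ (Subtype.mk.inj h)
  rwa [hc i] at this

end Exchange

/-! ### Supercommutativity of the Grassmann algebra -/

section Grassmann

variable {F : Type u} [Field F]

/-- Moving a vector past `u` costs one sign per vector factor of `u`, which is exactly the grade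
involution. -/
theorem ι_mul_eq_involute_mul_ι (v : ℕ →₀ F) (u : Grassmann F) :
    ExteriorAlgebra.ι F v * u = CliffordAlgebra.involute u * ExteriorAlgebra.ι F v := by
  induction u using ExteriorAlgebra.induction with
  | algebraMap r => rw [AlgHom.commutes, Algebra.commutes]
  | ι x =>
    rw [eq_neg_of_add_eq_zero_left (ExteriorAlgebra.ι_add_mul_swap v x), ← neg_mul]
    exact congrArg (· * _) (CliffordAlgebra.involute_ι x).symm
  | mul a b ha hb => rw [← mul_assoc, ha, mul_assoc, hb, map_mul, mul_assoc]
  | add a b ha hb => rw [mul_add, ha, hb, map_add, add_mul]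

theorem ι_mul_ι_mul_comm (v w : ℕ →₀ F) (u : Grassmann F) :
    ExteriorAlgebra.ι F v * ExteriorAlgebra.ι F w * u =
      u * (ExteriorAlgebra.ι F v * ExteriorAlgebra.ι F w) := by
  rw [mul_assoc, ι_mul_eq_involute_mul_ι w, ← mul_assoc, ι_mul_eq_involute_mul_ι v,
    CliffordAlgebra.involute_involute, mul_assoc]

theorem even_mul_comm {g : Grassmann F} (hg : g ∈ grassmannPart F 0) (u : Grassmann F) :
    g * u = u * g := by
  induction g, hg using CliffordAlgebra.even_induction with
  | algebraMap r => exact Algebra.commutes r u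
  | add x y _ _ hx hy => rw [add_mul, hx, hy, mul_add]
  | ι_mul_ι_mul v w x _ hx =>
    rw [mul_assoc, hx, ← mul_assoc u]
    exact (mul_assoc _ _ _).symm.trans (congrArg (· * x) (ι_mul_ι_mul_comm v w u))

theorem odd_mul_eq {g : Grassmann F} (hg : g ∈ grassmannPart F 1) (u : Grassmann F) :
    g * u = CliffordAlgebra.involute u * g := by
  induction g, hg using CliffordAlgebra.odd_induction with
  | ι v => exact ι_mul_eq_involute_mul_ι v u
  | add x y _ _ hx hy => rw [add_mul, hx, hy, mul_add]
  | ι_mul_ι_mul v w x _ hx =>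
    rw [mul_assoc, hx, ← mul_assoc (CliffordAlgebra.involute u)]
    exact (mul_assoc _ _ _).symm.trans
      (congrArg (· * x) (ι_mul_ι_mul_comm v w (CliffordAlgebra.involute u)))

/-- The sign `(-1)^i` as an integral unit. -/
def paritySign (i : ZMod 2) : ℤˣ := if i = 0 then 1 else -1

theorem exchange_grassmann {i : ZMod 2} {g h : Grassmann F} (hg : g ∈ grassmannPart F i)
    (hh : h ∈ grassmannPart F i) : Exchange (paritySign i) g h := by
  intro u
  rcases FreeMetabelian.zmod_two_cases i with rfl | rfl
  · rw [paritySign, if_pos rfl, Units.val_one, one_smul, mul_assoc, even_mul_comm hg,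
      ← even_mul_comm hh, mul_assoc]
  · rw [paritySign, if_neg one_ne_zero, Units.val_neg, Units.val_one, neg_smul, one_smul,
      odd_mul_eq hg, odd_mul_eq hh, mul_assoc, odd_mul_eq hg,
      CliffordAlgebra.involute_eq_of_mem_odd hh, neg_mul, mul_neg, mul_assoc]

/-- The second tensor factors agree, so interchanging the two elements only affects the Grassmann
factors, whatever `E` is. -/
theorem exchange_tmul {E : Type*} [Ring E] [Algebra F E] {i : ZMod 2} {g h : Grassmann F}
    (hg : g ∈ grassmannPart F i) (hh : h ∈ grassmannPart F i) (a : E) :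
    Exchange (paritySign i) (g ⊗ₜ[F] a) (h ⊗ₜ[F] a) := by
  intro u
  induction u using TensorProduct.induction_on with
  | zero => simp
  | add u v hu hv => simp only [mul_add, add_mul, hu, hv, smul_add]
  | tmul u b =>
    simp only [Algebra.TensorProduct.tmul_mul_tmul]
    rw [exchange_grassmann hg hh u, TensorProduct.smul_tmul']

end Grassmann

/-! ### The separating polynomial -/

section Polynomial

variable {F : Type u} [Field F] {m k : ℕ}

/-- Multilinearity allows the vanishing to be tested on a spanning set of the envelope. -/
theorem exists_multilinearMap_doubleSym (F : Type*) [Field F] (ε : ℤˣ) (m k : ℕ) (T : Type*)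
    [Ring T] [Algebra F T] :
    ∃ Φ : MultilinearMap F (fun _ : Fin m × Fin k => T) T, ∀ X, Φ X = doubleSym ε X := by
  let M : MultilinearMap F (fun _ : Fin m × Fin k => T) T :=
    (MultilinearMap.mkPiAlgebraFin F (m * k) T).domDomCongr finProdFinEquiv.symm
  refine ⟨∑ σ : Fin k → Equiv.Perm (Fin m), ∑ τ : Fin m → Equiv.Perm (Fin k),
    (signChar ε _ (rowPerm σ) : ℤ) • (signChar (-ε) _ (blockPerm τ) : ℤ) •
      M.domDomCongr (rowPerm σ * blockPerm τ), fun X => ?_⟩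
  simp only [sum_apply, smul_apply, doubleSym]
  rfl

/-- A linear map `C → C'` induces no homomorphism between endomorphism algebras, so compatibility is
expressed by evaluating on a vector. -/
theorem map_doubleSym_apply {C C' : Type*} [AddCommGroup C] [AddCommGroup C'] [Module F C]
    [Module F C'] (φ : C →ₗ[F] C') (ε : ℤˣ) (X : Fin m × Fin k → Module.End F C)
    (X' : Fin m × Fin k → Module.End F C') (h : ∀ p c, φ (X p c) = X' p (φ c)) (c : C) :
    φ (doubleSym ε X c) = doubleSym ε X' (φ c) := by
  have hl : ∀ (l : List (Fin m × Fin k)) (c : C),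
      φ ((l.map X).prod c) = (l.map X').prod (φ c) := by
    intro l
    induction l with
    | nil => intro c; rfl
    | cons p l ih =>
      intro c
      simp only [List.map_cons, List.prod_cons, Module.End.mul_apply, h, ih]
  have hw : ∀ π c, φ (wordAt π X c) = wordAt π X' (φ c) := by
    intro π c
    have := hl (List.ofFn fun j => π (finProdFinEquiv.symm j)) c
    rwa [List.map_ofFn, List.map_ofFn] at this
  simp only [doubleSym, LinearMap.sum_apply, LinearMap.smul_apply, map_sum, map_zsmul, hw]

theorem map_doubleSym {T T' : Type*} [Ring T] [Ring T'] [Algebra F T] [Algebra F T']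
    (θ : T →ₐ[F] T') (ε : ℤˣ)
    (X : Fin m × Fin k → T) : θ (doubleSym ε X) = doubleSym ε (θ ∘ X) := by
  simp only [doubleSym, wordAt, map_sum, map_zsmul, map_list_prod, List.map_ofFn]
  rfl

open FreeNonUnitalNonAssocAlgebra in
/-- The doubly symmetrized product of the left multiplications by the variables with indices
`≥ 2`, applied to the product of the first two variables. -/
def rectPolynomial (F : Type u) [Field F] (ε : ℤˣ) (m k : ℕ) :
    FreeNonUnitalNonAssocAlgebra F (Fin (m * k + 2)) :=
  doubleSym ε (fun p => LinearMap.mulLeft F (of F (finProdFinEquiv p).succ.succ))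
    (of F 0 * of F 1)

theorem isMultilinear_rectPolynomial (ε : ℤˣ) (m k : ℕ) :
    IsMultilinear (rectPolynomial F ε m k) := by
  -- Multilinear polynomials form a subspace, so each signed monomial can be checked alone.
  let S : Submodule F (FreeNonUnitalNonAssocAlgebra F (Fin (m * k + 2))) :=
    { carrier := {f | IsMultilinear f}
      zero_mem' := fun w hw => (hw rfl).elim
      add_mem' := fun {f g} hf hg w hw i => by
        by_cases h : f.coeff w = 0
        · by_cases h' : g.coeff w = 0
          · exact (hw (by simp [h, h'])).elim
          · exact hg w h' i
        · exact hf w h i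
      smul_mem' := fun c f hf w hw i => hf w (fun h => hw (by simp [h])) i }
  let word : List (Fin m × Fin k) → FreeMagma (Fin (m * k + 2)) := fun l =>
    l.foldr (fun p w => .mul (.of (finProdFinEquiv p).succ.succ) w) (.mul (.of 0) (.of 1))
  have hword : ∀ l : List (Fin m × Fin k),
      (l.map fun p => LinearMap.mulLeft F
        (FreeNonUnitalNonAssocAlgebra.of F (finProdFinEquiv p).succ.succ)).prod
        (FreeNonUnitalNonAssocAlgebra.of F 0 * FreeNonUnitalNonAssocAlgebra.of F 1) =
      MonoidAlgebra.ofMagma F _ (word l) := by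
    intro l
    induction l with
    | nil => exact (map_mul (MonoidAlgebra.ofMagma F (FreeMagma (Fin (m * k + 2)))) _ _).symm
    | cons p l ih =>
      rw [List.map_cons, List.prod_cons, Module.End.mul_apply, ih]
      exact (map_mul (MonoidAlgebra.ofMagma F (FreeMagma (Fin (m * k + 2)))) _ _).symm
  have hcount : ∀ (l : List (Fin m × Fin k)) (i : Fin (m * k + 2)),
      varCount i (word l) = (l.map fun p => (finProdFinEquiv p).succ.succ).count i +
        ((if 0 = i then 1 else 0) + if 1 = i then 1 else 0) := by
    intro l i
    induction l with
    | nil => simp [word, varCount]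
    | cons p l ih =>
      change (if (finProdFinEquiv p).succ.succ = i then 1 else 0) + varCount i (word l) = _
      rw [ih, List.map_cons, List.count_cons]
      simp only [beq_iff_eq]
      ring
  have hmem : ∀ π : Equiv.Perm (Fin m × Fin k), wordAt π (fun p => LinearMap.mulLeft F
        (FreeNonUnitalNonAssocAlgebra.of F (finProdFinEquiv p).succ.succ))
        (FreeNonUnitalNonAssocAlgebra.of F 0 * FreeNonUnitalNonAssocAlgebra.of F 1) ∈ S := by
    intro π
    have h := hword (List.ofFn fun j => π (finProdFinEquiv.symm j))
    rw [List.map_ofFn] at h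
    rw [wordAt]
    refine (congrArg (· ∈ S) h).mpr fun w hw i => ?_
    obtain rfl : word (List.ofFn fun j => π (finProdFinEquiv.symm j)) = w := by
      by_contra hne
      exact hw (by simp [MonoidAlgebra.ofMagma, hne, -finProdFinEquiv_symm_apply])
    rw [hcount, List.map_ofFn]
    have hinj : Function.Injective ((fun p : Fin m × Fin k => (finProdFinEquiv p).succ.succ) ∘
        fun j => π (finProdFinEquiv.symm j)) := fun a b hab => by
      simpa [-finProdFinEquiv_symm_apply] using hab
    refine Fin.cases ?_ (fun i => Fin.cases ?_ (fun i => ?_) i) i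
    · rw [List.count_eq_zero_of_not_mem]
      · simp
      · simp [List.mem_ofFn, Fin.succ_ne_zero]
    · rw [List.count_eq_zero_of_not_mem]
      · simp
      · simp [List.mem_ofFn, Fin.ext_iff]
    · rw [List.count_eq_one_of_mem (List.nodup_ofFn.2 hinj)]
      · simp [Fin.ext_iff]
      · exact List.mem_ofFn.2 ⟨finProdFinEquiv (π.symm (finProdFinEquiv.symm i)),
          by simp [-finProdFinEquiv_symm_apply]⟩
  change _ ∈ S
  simp only [rectPolynomial, doubleSym, LinearMap.sum_apply, LinearMap.smul_apply]
  exact S.sum_mem fun σ _ => S.sum_mem fun τ _ =>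
    zsmul_mem (zsmul_mem (hmem _) _) _

theorem map_rectPolynomial {C : Type*} [NonUnitalNonAssocRing C] [Module F C]
    [IsScalarTower F C C] [SMulCommClass F C C] (ε : ℤˣ)
    (φ : FreeNonUnitalNonAssocAlgebra F (Fin (m * k + 2)) →ₙₐ[F] C) :
    φ (rectPolynomial F ε m k) =
      doubleSym ε (fun p => LinearMap.mulLeft F
        (φ (FreeNonUnitalNonAssocAlgebra.of F (finProdFinEquiv p).succ.succ)))
        (φ (FreeNonUnitalNonAssocAlgebra.of F 0) * φ (FreeNonUnitalNonAssocAlgebra.of F 1)) := by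
  rw [← map_mul]
  exact map_doubleSym_apply (φ : FreeNonUnitalNonAssocAlgebra F (Fin (m * k + 2)) →ₗ[F] C)
    ε _ _ (fun p c => map_mul φ _ _) _

end Polynomial

/-! ### Left multiplications in `G ⊗ A` -/

section LeftMul

variable {F : Type u} [Field F] {m k : ℕ} {A : Type*} [NonUnitalNonAssocRing A] [Module F A]

variable (F A) in
/-- The action of `G ⊗ End A` on `G ⊗ A`. -/
def tensorAction : Grassmann F ⊗[F] Module.End F A →ₐ[F] Module.End F (Grassmann F ⊗[F] A) :=
  (Module.endTensorEndAlgHom (R := F) (S := F) (A := F) (M := Grassmann F) (N := A)).comp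
    (Algebra.TensorProduct.map (Algebra.lmul F (Grassmann F)) (AlgHom.id F _))

theorem tensorAction_tmul_tmul (g h : Grassmann F) (e : Module.End F A) (a : A) :
    tensorAction F A (g ⊗ₜ e) (h ⊗ₜ a) = (g * h) ⊗ₜ e a := rfl

variable [IsScalarTower F A A] [SMulCommClass F A A]

variable (F A) in
/-- The map `g ⊗ a ↦ g ⊗ L_a`. -/
def tensorLeft : Grassmann F ⊗[F] A →ₗ[F] Grassmann F ⊗[F] Module.End F A :=
  LinearMap.lTensor (Grassmann F) (LinearMap.mul F A)

theorem tensorLeft_tmul (g : Grassmann F) (a : A) :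
    tensorLeft F A (g ⊗ₜ a) = g ⊗ₜ LinearMap.mulLeft F a := rfl

theorem tensorAction_tensorLeft (c : Grassmann F ⊗[F] A) :
    tensorAction F A (tensorLeft F A c) = LinearMap.mulLeft F c := by
  induction c using TensorProduct.induction_on with
  | zero => rw [map_zero, map_zero, LinearMap.mulLeft_zero_eq_zero]
  | add c d hc hd =>
    rw [map_add, map_add, hc, hd]
    exact LinearMap.ext fun x => (add_mul c d x).symm
  | tmul g a =>
    ext h b
    exact (Algebra.TensorProduct.tmul_mul_tmul g h a b).symm

/-- Moves the computation into the associative algebra `G ⊗ End A`, where the sign rule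
`exchange_tmul` applies. -/
theorem doubleSym_mulLeft_apply (ε : ℤˣ) (x : Fin m × Fin k → Grassmann F ⊗[F] A)
    (c : Grassmann F ⊗[F] A) :
    doubleSym ε (fun p => LinearMap.mulLeft F (x p)) c =
      tensorAction F A (doubleSym ε fun p => tensorLeft F A (x p)) c := by
  have h := map_doubleSym (T' := Module.End F (Grassmann F ⊗[F] A)) (tensorAction F A) ε
    fun p => tensorLeft F A (x p)
  have h' : (⇑(tensorAction F A) ∘
      fun p => tensorLeft F A (x p)) = fun p => LinearMap.mulLeft F (x p) :=
    funext fun p => tensorAction_tensorLeft (x p)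
  rw [h'] at h
  rw [← h]

end LeftMul

/-! ### Identities of the free metabelian superalgebras -/

section Vanishing

/-- Induction on the set of arguments that are allowed to lie in the span rather than in `S` itself.
-/
theorem MultilinearMap.eq_zero_of_mem_span {R ι M N : Type*} [CommRing R] [AddCommGroup M]
    [AddCommGroup N] [Module R M] [Module R N] [Fintype ι]
    (Φ : MultilinearMap R (fun _ : ι => M) N) (S : Set M)
    (hS : ∀ x : ι → M, (∀ i, x i ∈ S) → Φ x = 0) (x : ι → M)
    (hx : ∀ i, x i ∈ Submodule.span R S) : Φ x = 0 := by
  classical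
  have key : ∀ s : Finset ι, ∀ x : ι → M, (∀ i ∈ s, x i ∈ Submodule.span R S) →
      (∀ i ∉ s, x i ∈ S) → Φ x = 0 := by
    intro s
    induction s using Finset.induction_on with
    | empty => exact fun x _ h => hS x fun i => h i (Finset.notMem_empty i)
    | insert a s ha ih =>
      intro x h₁ h₂
      rw [← Function.update_eq_self a x]
      have ha' := h₁ a (Finset.mem_insert_self a s)
      generalize x a = v at ha'
      induction ha' using Submodule.span_induction with
      | mem v hv =>
        refine ih _ (fun i hi => ?_) fun i hi => ?_
        · rw [Function.update_of_ne (ne_of_mem_of_not_mem hi ha)]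
          exact h₁ i (Finset.mem_insert_of_mem hi)
        · by_cases hia : i = a
          · rw [hia, Function.update_self]; exact hv
          · rw [Function.update_of_ne hia]
            exact h₂ i fun h => (Finset.mem_insert.1 h).elim hia hi
      | zero => rw [Φ.map_update_zero]
      | add v w _ _ hv hw => rw [Φ.map_update_add, hv, hw, add_zero]
      | smul c v _ hv => rw [Φ.map_update_smul, hv, smul_zero]
  exact key Finset.univ x (fun i _ => hx i) fun i hi => (hi (Finset.mem_univ i)).elim

/-- The class of the generator `x`. -/
def FreeMetabelian.gen (F : Type u) [Field F] {X : Type} (x : X) : FreeMetabelian F X :=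
  FreeMetabelian.mk F X (FreeNonUnitalNonAssocAlgebra.of F x)

variable {F : Type u} [Field F] {X : Type} {m k : ℕ}

/-- A word is a generator or a product. For products the parity of `g` is dropped, since
metabelianity kills them regardless of sign. -/
theorem tmul_mem_span_of_mem_part (p : X → ZMod 2) (i : ZMod 2) {g : Grassmann F}
    (hg : g ∈ grassmannPart F i) {a : FreeMetabelian F X} (ha : a ∈ FreeMetabelian.part F p i) :
    g ⊗ₜ[F] a ∈ Submodule.span F
      ({t | ∃ x, ∃ g ∈ grassmannPart F (p x), t = g ⊗ₜ[F] FreeMetabelian.gen F x} ∪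
        {t | ∃ (g : Grassmann F) (b c : FreeMetabelian F X), t = g ⊗ₜ[F] (b * c)}) := by
  induction ha using Submodule.span_induction with
  | zero => rw [TensorProduct.tmul_zero]; exact Submodule.zero_mem _
  | add a b _ _ ha hb => rw [TensorProduct.tmul_add]; exact Submodule.add_mem _ ha hb
  | smul c a _ ha => rw [TensorProduct.tmul_smul]; exact Submodule.smul_mem _ _ ha
  | mem a ha =>
    obtain ⟨w, rfl, rfl⟩ := ha
    refine Submodule.subset_span ?_
    cases w with
    | of x => exact Or.inl ⟨x, g, hg, rfl⟩
    | mul v w =>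
      refine Or.inr ⟨g, FreeMetabelian.mk F X (MonoidAlgebra.ofMagma F _ v),
        FreeMetabelian.mk F X (MonoidAlgebra.ofMagma F _ w), ?_⟩
      rw [← FreeMetabelian.mk_mul, ← map_mul]
      rfl

theorem tmul_mul_mul_tensorLeft (g : Grassmann F) (a b : FreeMetabelian F X)
    (c : Grassmann F ⊗[F] FreeMetabelian F X) :
    tensorLeft F (FreeMetabelian F X) (g ⊗ₜ (a * b)) * tensorLeft F (FreeMetabelian F X) c =
      0 := by
  induction c using TensorProduct.induction_on with
  | zero => rw [map_zero, mul_zero]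
  | add c d hc hd => rw [map_add, mul_add, hc, hd, add_zero]
  | tmul h c =>
    rw [tensorLeft_tmul, tensorLeft_tmul, Algebra.TensorProduct.tmul_mul_tmul]
    have : LinearMap.mulLeft F (a * b) * LinearMap.mulLeft F c = 0 :=
      LinearMap.ext fun d => FreeMetabelian.mul_mul_mul_eq_zero a b c d
    rw [this, TensorProduct.tmul_zero]

/-- The extra factor on the right makes the argument cover a product standing in the last place of
the word: it is still followed by a left multiplication. -/
theorem doubleSym_tensorLeft_mul_eq_zero [CharZero F] [Fintype X] {ε : ℤˣ} (p : X → ZMod 2)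
    (hk : Fintype.card {x // paritySign (p x) = ε} < k)
    (hm : k * Fintype.card {x // paritySign (p x) = -ε} < m)
    (x : Fin m × Fin k → Grassmann F ⊗[F] FreeMetabelian F X)
    (y : Grassmann F ⊗[F] FreeMetabelian F X)
    (hx : ∀ q, x q ∈ Submodule.span F {t | ∃ (i : ZMod 2) (g : Grassmann F)
      (a : FreeMetabelian F X), g ∈ grassmannPart F i ∧ a ∈ FreeMetabelian.part F p i ∧
        t = g ⊗ₜ[F] a}) :
    doubleSym ε (fun q => tensorLeft F _ (x q)) * tensorLeft F _ y = 0 := by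
  obtain ⟨Φ, hΦ⟩ := exists_multilinearMap_doubleSym F ε m k
    (Grassmann F ⊗[F] Module.End F (FreeMetabelian F X))
  have : IsAddTorsionFree (Grassmann F ⊗[F] Module.End F (FreeMetabelian F X)) :=
    IsAddTorsionFree.of_isTorsionFree F _
  have h := MultilinearMap.eq_zero_of_mem_span
    ((LinearMap.mulRight F (tensorLeft F _ y)).compMultilinearMap
      (Φ.compLinearMap fun _ => tensorLeft F (FreeMetabelian F X)))
    ({t | ∃ x, ∃ g ∈ grassmannPart F (p x), t = g ⊗ₜ[F] FreeMetabelian.gen F x} ∪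
        {t | ∃ (g : Grassmann F) (b c : FreeMetabelian F X), t = g ⊗ₜ[F] (b * c)}) ?_ x ?_
  · exact (congrArg (· * tensorLeft F _ y) (hΦ _)).symm.trans h
  · clear hx x
    intro x hx
    refine (congrArg (· * tensorLeft F _ y) (hΦ fun q => tensorLeft F _ (x q))).trans ?_
    change doubleSym ε (fun q => tensorLeft F _ (x q)) * tensorLeft F _ y = 0
    by_cases hprod : ∃ q, ∃ (g : Grassmann F) (b c : FreeMetabelian F X), x q = g ⊗ₜ[F] (b * c)
    · obtain ⟨q, g, b, c, hq⟩ := hprod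
      simp only [doubleSym, Finset.sum_mul, smul_mul_assoc]
      refine Finset.sum_eq_zero fun σ _ => Finset.sum_eq_zero fun τ _ => ?_
      rw [wordAt_eq_zero_of_mul_eq_zero _ _ _ q, smul_zero, smul_zero]
      · intro q'
        rw [hq, tmul_mul_mul_tensorLeft]
      · rw [hq, tmul_mul_mul_tensorLeft]
    · have hgen : ∀ q, ∃ l, ∃ g ∈ grassmannPart F (p l), x q = g ⊗ₜ[F] FreeMetabelian.gen F l :=
        fun q => (hx q).resolve_right fun h => hprod ⟨q, h⟩
      choose lab g hg hgx using hgen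
      rw [doubleSym_eq_zero_of_labels (fun l => paritySign (p l)) lab ?_ hk hm, zero_mul]
      intro q q' hqq
      rw [hgx q, hgx q', tensorLeft_tmul, tensorLeft_tmul, ← hqq]
      exact exchange_tmul (hg q) (hqq ▸ hg q') _
  · intro q
    refine (Submodule.span_le.2 ?_) (hx q)
    rintro _ ⟨i, g, a, hg, ha, rfl⟩
    exact tmul_mem_span_of_mem_part p i hg ha

theorem Superalgebra.coe_lift_rectPolynomial (A : Superalgebra F) (ε : ℤˣ)
    (x : Fin (m * k + 2) → A.envelope) :
    (FreeNonUnitalNonAssocAlgebra.lift F x (rectPolynomial F ε m k) :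
        Grassmann F ⊗[F] A.carrier) =
      tensorAction F A.carrier
        (doubleSym ε fun p => tensorLeft F A.carrier (x (finProdFinEquiv p).succ.succ))
        (x 0 * x 1 : Grassmann F ⊗[F] A.carrier) := by
  have h := map_rectPolynomial ε
    ((NonUnitalSubalgebraClass.subtype A.envelope).comp (FreeNonUnitalNonAssocAlgebra.lift F x))
  simp only [NonUnitalAlgHom.comp_apply, FreeNonUnitalNonAssocAlgebra.lift_of_apply] at h
  exact h.trans (doubleSym_mulLeft_apply ε
    (fun p => (x (finProdFinEquiv p).succ.succ : Grassmann F ⊗[F] A.carrier)) _)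

theorem tensorAction_mul {A : Type*} [NonUnitalNonAssocRing A] [Module F A]
    [IsScalarTower F A A] [SMulCommClass F A A] (t : Grassmann F ⊗[F] Module.End F A)
    (c d : Grassmann F ⊗[F] A) :
    tensorAction F A t (c * d) = tensorAction F A (t * tensorLeft F A c) d := by
  rw [map_mul (tensorAction F A), Module.End.mul_apply, tensorAction_tensorLeft,
    LinearMap.mulLeft_apply]

theorem satisfiesSuperidentity_rectPolynomial [CharZero F] (r s : ℕ) (ε : ℤˣ)
    (hk : Fintype.card {x : Fin r ⊕ Fin s //
      paritySign (Sum.elim (fun _ => 0) (fun _ => 1) x) = ε} < k)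
    (hm : k * Fintype.card {x : Fin r ⊕ Fin s //
      paritySign (Sum.elim (fun _ => 0) (fun _ => 1) x) = -ε} < m) :
    (freeMetabelianSuperalgebra F r s).SatisfiesSuperidentity (rectPolynomial F ε m k) := by
  intro x
  refine Subtype.ext ?_
  -- The base product `x 0 * x 1` supplies the extra factor: it is the left multiplication by `x 0`
  -- applied to `x 1`.
  rw [Superalgebra.coe_lift_rectPolynomial, tensorAction_mul]
  have := doubleSym_tensorLeft_mul_eq_zero (F := F) _ hk hm
    (fun p => (x (finProdFinEquiv p).succ.succ).1) (x 0).1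
    (fun q => (x (finProdFinEquiv q).succ.succ).2)
  refine (congrArg (fun t => tensorAction F (FreeMetabelian F (Fin r ⊕ Fin s)) t (x 1).1)
    this).trans ?_
  rw [map_zero (tensorAction F (FreeMetabelian F (Fin r ⊕ Fin s)))]
  rfl

end Vanishing

/-! ### Separation of words in the free metabelian algebra -/

section Separation

/-- The space spanned by the generators and by the words in the generators. -/
def WordAlgebra (F : Type u) [Field F] (X : Type) : Type u := (X →₀ F) × (List X →₀ F)

namespace WordAlgebra

variable {F : Type u} [Field F] {X : Type}

instance : AddCommGroup (WordAlgebra F X) :=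
  inferInstanceAs (AddCommGroup ((X →₀ F) × (List X →₀ F)))

instance : Module F (WordAlgebra F X) :=
  inferInstanceAs (Module F ((X →₀ F) × (List X →₀ F)))

/-- A generator `x` takes a word `l` to the word `x :: l`. -/
def action : (X →₀ F) →ₗ[F] (List X →₀ F) →ₗ[F] (List X →₀ F) :=
  Finsupp.linearCombination F fun x => Finsupp.lmapDomain F F (List.cons x)

/-- The product of two generators is the empty word. -/
def base : (X →₀ F) →ₗ[F] (X →₀ F) →ₗ[F] (List X →₀ F) :=
  Finsupp.linearCombination F fun _ =>
    Finsupp.linearCombination F fun _ => Finsupp.single [] 1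

instance : Mul (WordAlgebra F X) where
  mul a b := (0, base a.1 b.1 + action a.1 b.2)

/-- The element with components `a` and `b`. -/
def pair (a : X →₀ F) (b : List X →₀ F) : WordAlgebra F X := (a, b)

theorem pair_mul_pair (a c : X →₀ F) (b d : List X →₀ F) :
    pair a b * pair c d = pair 0 (base a c + action a d) := rfl

instance : NonUnitalNonAssocRing (WordAlgebra F X) where
  left_distrib a b c := by
    refine Prod.ext (add_zero 0).symm ?_
    change base a.1 (b.1 + c.1) + action a.1 (b.2 + c.2) =
      (base a.1 b.1 + action a.1 b.2) + (base a.1 c.1 + action a.1 c.2)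
    rw [map_add, map_add]; abel
  right_distrib a b c := by
    refine Prod.ext (add_zero 0).symm ?_
    change base (a.1 + b.1) c.1 + action (a.1 + b.1) c.2 =
      (base a.1 c.1 + action a.1 c.2) + (base b.1 c.1 + action b.1 c.2)
    rw [map_add, map_add, LinearMap.add_apply, LinearMap.add_apply]; abel
  zero_mul a := by
    refine Prod.ext rfl ?_
    change base 0 a.1 + action 0 a.2 = 0
    simp
  mul_zero a := by
    refine Prod.ext rfl ?_
    change base a.1 0 + action a.1 0 = 0
    simp

instance : IsScalarTower F (WordAlgebra F X) (WordAlgebra F X) where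
  smul_assoc c a b := by
    refine Prod.ext (smul_zero c).symm ?_
    change base (c • a.1) b.1 + action (c • a.1) b.2 = c • (base a.1 b.1 + action a.1 b.2)
    simp

instance : SMulCommClass F (WordAlgebra F X) (WordAlgebra F X) where
  smul_comm c a b := by
    refine Prod.ext (smul_zero c) ?_
    change c • (base a.1 b.1 + action a.1 b.2) = base a.1 (c • b.1) + action a.1 (c • b.2)
    simp

theorem mul_mul_mul_eq_zero (a b c d : WordAlgebra F X) : (a * b) * (c * d) = 0 := by
  refine Prod.ext rfl ?_
  change base 0 _ + action 0 _ = 0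
  simp

/-- The homomorphism from the free metabelian algebra which is the identity on generators. -/
def ofFree : FreeMetabelian F X →ₙₐ[F] WordAlgebra F X :=
  FreeMetabelian.lift mul_mul_mul_eq_zero
    fun x => pair (Finsupp.single x 1) 0

theorem ofFree_gen (x : X) : ofFree (FreeMetabelian.gen F x) = pair (Finsupp.single x 1) 0 :=
  (FreeMetabelian.lift_mk _ _ _).trans (FreeNonUnitalNonAssocAlgebra.lift_of_apply _ _ _)

theorem ofFree_word (x y : X) (l : List X) :
    ofFree ((l.map fun x => LinearMap.mulLeft F (FreeMetabelian.gen F x)).prod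
      (FreeMetabelian.gen F x * FreeMetabelian.gen F y)) =
      pair 0 (Finsupp.single l 1) := by
  induction l with
  | nil =>
    rw [List.map_nil, List.prod_nil, Module.End.one_apply, map_mul, ofFree_gen, ofFree_gen,
      pair_mul_pair]
    simp [base]
  | cons z l ih =>
    rw [List.map_cons, List.prod_cons, Module.End.mul_apply, LinearMap.mulLeft_apply, map_mul,
      ih, ofFree_gen, pair_mul_pair]
    simp [action]

end WordAlgebra

variable {F : Type u} [Field F] {X : Type}

/-- The coefficients of words are well defined on the free metabelian algebra. -/
theorem exists_word_coeff (l : List X) :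
    ∃ φ : FreeMetabelian F X →ₗ[F] F, ∀ x y l', φ
      ((List.map (fun x => LinearMap.mulLeft F (FreeMetabelian.gen F x)) l').prod
        (FreeMetabelian.gen F x * FreeMetabelian.gen F y)) =
      Finsupp.single l' (1 : F) l := by
  let π : WordAlgebra F X →ₗ[F] F :=
    (Finsupp.lapply l).comp (LinearMap.snd F (X →₀ F) (List X →₀ F))
  refine ⟨π.comp (WordAlgebra.ofFree (F := F) (X := X) : FreeMetabelian F X →ₗ[F] WordAlgebra F X),
    fun x y l' => ?_⟩
  exact congrArg π (WordAlgebra.ofFree_word x y l')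

end Separation

/-! ### Nonvanishing of the separating polynomial -/

section Nonvanishing

variable {F : Type u} [Field F] {m k : ℕ}

/-- Projecting onto the first `n` coordinates and applying the determinant sends this product to
`det 1 = 1`. -/
theorem ιMulti_single_ne_zero (n : ℕ) :
    ExteriorAlgebra.ιMulti F n (fun j : Fin n => (Finsupp.single (j : ℕ) 1 : ℕ →₀ F)) ≠ 0 := by
  intro h
  let res : (ℕ →₀ F) →ₗ[F] (Fin n → F) := LinearMap.pi fun j => Finsupp.lapply (j : ℕ)
  have h' := congrArg (ExteriorAlgebra.map res) h
  rw [ExteriorAlgebra.map_apply_ιMulti, map_zero] at h'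
  let f : ∀ i, (Fin n → F) [⋀^Fin i]→ₗ[F] F := fun i =>
    if hi : n = i then hi ▸ Matrix.detRowAlternating else 0
  have h'' := congrArg (ExteriorAlgebra.liftAlternating f) h'
  rw [ExteriorAlgebra.liftAlternating_apply_ιMulti, map_zero] at h''
  simp only [f, dif_pos] at h''
  have hone : (⇑res ∘ fun j : Fin n => (Finsupp.single (j : ℕ) 1 : ℕ →₀ F)) =
      (1 : Matrix (Fin n) (Fin n) F) := by
    ext i j
    simp [res, Matrix.one_apply, Finsupp.single_apply, Fin.ext_iff]
  rw [hone] at h''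
  exact one_ne_zero (Matrix.det_one.symm.trans h'')

/-- In the even case all coefficients can be `1`; in the odd case they are `m * k + 2` distinct
Grassmann generators. -/
theorem exists_grassmann_word_ne_zero (F : Type u) [Field F] (i : ZMod 2) (m k : ℕ) :
    ∃ (g : Fin m × Fin k → Grassmann F) (a b : Grassmann F),
      (∀ p, g p ∈ grassmannPart F i) ∧ a ∈ grassmannPart F i ∧ b ∈ grassmannPart F i ∧
        wordAt 1 g * (a * b) ≠ 0 := by
  rcases FreeMetabelian.zmod_two_cases i with rfl | rfl
  · have h1 : (1 : Grassmann F) ∈ grassmannPart F 0 := SetLike.one_mem_graded _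
    refine ⟨fun _ => 1, 1, 1, fun _ => h1, h1, h1, ?_⟩
    simp [wordAt]
  · let e : ℕ → Grassmann F := fun j => ExteriorAlgebra.ι F (Finsupp.single j 1)
    have he : ∀ j, e j ∈ grassmannPart F 1 := fun j => CliffordAlgebra.ι_mem_evenOdd_one _ _
    refine ⟨fun p => e (finProdFinEquiv p), e (m * k), e (m * k + 1), fun _ => he _, he _, he _,
      ?_⟩
    have h := ιMulti_single_ne_zero (F := F) (m * k + 2)
    rw [ExteriorAlgebra.ιMulti_apply, List.ofFn_succ', List.ofFn_succ'] at h
    simpa [wordAt, -finProdFinEquiv_symm_apply, mul_assoc] using h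

theorem wordAt_tmul {E : Type*} [Ring E] [Algebra F E] (π : Equiv.Perm (Fin m × Fin k))
    (g : Fin m × Fin k → Grassmann F) (e : Fin m × Fin k → E) :
    wordAt π (fun p => g p ⊗ₜ[F] e p) = wordAt π g ⊗ₜ[F] wordAt π e := by
  have key : ∀ l : List (Fin m × Fin k), (l.map fun p => g p ⊗ₜ[F] e p).prod =
      (l.map g).prod ⊗ₜ[F] (l.map e).prod := by
    intro l
    induction l with
    | nil => rfl
    | cons p l ih =>
      rw [List.map_cons, List.prod_cons, ih, Algebra.TensorProduct.tmul_mul_tmul]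
      rfl
  have := key (List.ofFn fun j => π (finProdFinEquiv.symm j))
  rwa [List.map_ofFn, List.map_ofFn, List.map_ofFn] at this

theorem tensorAction_doubleSym_ne_zero [CharZero F] {X : Type} (i : ZMod 2) {v : Fin k → X}
    (hv : Function.Injective v) (g : Fin m × Fin k → Grassmann F)
    (hg : ∀ p, g p ∈ grassmannPart F i) (a b : Grassmann F) (hab : wordAt 1 g * (a * b) ≠ 0)
    (x y : X) :
    tensorAction F (FreeMetabelian F X)
      (doubleSym (paritySign i) fun p => tensorLeft F (FreeMetabelian F X)
        (g p ⊗ₜ FreeMetabelian.gen F (v p.2)))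
      (a ⊗ₜ FreeMetabelian.gen F x * b ⊗ₜ FreeMetabelian.gen F y) ≠ 0 := by
  intro h
  -- Place `(c, l)` carries the letter `v (τ c l)`; as `v` is injective, the word determines `τ`.
  have hletters : ∀ τ : Fin m → Equiv.Perm (Fin k),
      (List.ofFn fun j => v (blockPerm τ (finProdFinEquiv.symm j)).2) =
        (List.ofFn fun j : Fin (m * k) => v (finProdFinEquiv.symm j).2) ↔ τ = 1 := by
    intro τ
    refine ⟨fun h => ?_, fun h => by rw [h, map_one]; rfl⟩
    have h' := List.ofFn_injective h
    funext c
    refine Equiv.ext fun l => hv ?_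
    have := congrFun h' (finProdFinEquiv (c, l))
    rwa [Equiv.symm_apply_apply] at this
  obtain ⟨φ, hφ⟩ := exists_word_coeff (F := F)
    (List.ofFn fun j : Fin (m * k) => v (finProdFinEquiv.symm j).2)
  simp_rw [tensorLeft_tmul] at h
  rw [doubleSym_eq_nsmul fun l c d => exchange_tmul (hg _) (hg _) _,
    Algebra.TensorProduct.tmul_mul_tmul, map_nsmul, LinearMap.smul_apply] at h
  have : IsAddTorsionFree (Grassmann F ⊗[F] FreeMetabelian F X) :=
    IsAddTorsionFree.of_isTorsionFree F _
  -- `ψ` extracts the Grassmann coefficient of the unpermuted word, to which only `τ = 1`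
  -- contributes.
  let ψ : Grassmann F ⊗[F] FreeMetabelian F X →ₗ[F] Grassmann F :=
    (TensorProduct.rid F (Grassmann F)).toLinearMap ∘ₗ LinearMap.lTensor (Grassmann F) φ
  have hterm : ∀ τ : Fin m → Equiv.Perm (Fin k),
      ψ (tensorAction F (FreeMetabelian F X)
        (wordAt (blockPerm τ) fun p => g p ⊗ₜ[F] LinearMap.mulLeft F
          (FreeMetabelian.gen F (v p.2)))
        ((a * b) ⊗ₜ[F] (FreeMetabelian.gen F x * FreeMetabelian.gen F y))) =
      if τ = 1 then wordAt (blockPerm τ) g * (a * b) else 0 := by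
    intro τ
    have hw := hφ x y (List.ofFn fun j => v (blockPerm τ (finProdFinEquiv.symm j)).2)
    rw [List.map_ofFn] at hw
    rw [wordAt_tmul, tensorAction_tmul_tmul]
    refine (congrArg (· • (wordAt (blockPerm τ) g * (a * b))) hw).trans ?_
    by_cases hτ : τ = 1
    · rw [if_pos hτ, (hletters τ).2 hτ, Finsupp.single_eq_same, one_smul]
    · rw [if_neg hτ, Finsupp.single_eq_of_ne fun h => hτ ((hletters τ).1 h.symm), zero_smul]
  have h := congrArg ψ ((smul_eq_zero.1 h).resolve_left Fintype.card_ne_zero)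
  simp only [map_sum, LinearMap.sum_apply, map_zsmul, LinearMap.smul_apply, map_zero] at h
  simp only [hterm, smul_ite, smul_zero, Finset.sum_ite_eq', Finset.mem_univ, if_true,
    map_one, Units.val_one, one_smul] at h
  exact hab h

theorem Superalgebra.SatisfiesSuperidentity.doubleSym_apply_eq_zero {A : Superalgebra F} {ε : ℤˣ}
    (h : A.SatisfiesSuperidentity (rectPolynomial F ε m k))
    (c : Fin m × Fin k → Grassmann F ⊗[F] A.carrier) (hc : ∀ p, c p ∈ A.envelope)
    {a b : Grassmann F ⊗[F] A.carrier} (ha : a ∈ A.envelope) (hb : b ∈ A.envelope) :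
    tensorAction F A.carrier (doubleSym ε fun p => tensorLeft F A.carrier (c p)) (a * b) = 0 := by
  let x : Fin (m * k + 2) → A.envelope :=
    Fin.cons ⟨a, ha⟩ (Fin.cons ⟨b, hb⟩ fun j => ⟨_, hc (finProdFinEquiv.symm j)⟩)
  have hx := congrArg Subtype.val (h x)
  rw [Superalgebra.coe_lift_rectPolynomial] at hx
  have hxc : (fun p => (x (finProdFinEquiv p).succ.succ).1) = c := by
    funext p
    change c (finProdFinEquiv.symm (finProdFinEquiv p)) = c p
    rw [Equiv.symm_apply_apply]
  have h₀ : (x 0).1 = a := rfl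
  have h₁ : (x 1).1 = b := by rw [← Fin.succ_zero_eq_one]; rfl
  rw [h₀, h₁] at hx
  rw [← hxc]
  exact hx

theorem not_satisfiesSuperidentity_rectPolynomial [CharZero F] (r s : ℕ) (i : ZMod 2) (hk : 0 < k)
    (v : Fin k → Fin r ⊕ Fin s) (hv : Function.Injective v)
    (hvi : ∀ j, Sum.elim (fun _ => 0) (fun _ => 1) (v j) = i) :
    ¬ (freeMetabelianSuperalgebra F r s).SatisfiesSuperidentity
      (rectPolynomial F (paritySign i) m k) := by
  intro h
  obtain ⟨g, a, b, hg, ha, hb, hab⟩ := exists_grassmann_word_ne_zero F i m k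
  have hmem : ∀ (g : Grassmann F) (j : Fin k), g ∈ grassmannPart F i →
      (g ⊗ₜ[F] FreeMetabelian.gen F (v j) : Grassmann F ⊗[F] FreeMetabelian F _) ∈
        Submodule.span F {t | ∃ (i : ZMod 2) (g : Grassmann F)
          (a : FreeMetabelian F (Fin r ⊕ Fin s)), g ∈ grassmannPart F i ∧
          a ∈ FreeMetabelian.part F (Sum.elim (fun _ => 0) (fun _ => 1)) i ∧ t = g ⊗ₜ[F] a} :=
    fun g j hg => Submodule.subset_span ⟨i, g, _, hg,
      Submodule.subset_span ⟨FreeMagma.of (v j), hvi j, rfl⟩, rfl⟩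
  exact tensorAction_doubleSym_ne_zero i hv g hg a b hab (v ⟨0, hk⟩) (v ⟨0, hk⟩)
    (h.doubleSym_apply_eq_zero _ (fun p => hmem (g p) p.2 (hg p)) (hmem a _ ha) (hmem b _ hb))

end Nonvanishing

/-! ### Comparison of the ranks -/

theorem card_even_generators (r s : ℕ) : Fintype.card {x : Fin r ⊕ Fin s //
    paritySign (Sum.elim (fun _ => 0) (fun _ => 1) x) = 1} = r := by
  rw [Fintype.card_subtype, Finset.card_filter, Fintype.sum_sum_type]
  simp [paritySign]

theorem card_odd_generators (r s : ℕ) : Fintype.card {x : Fin r ⊕ Fin s //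
    paritySign (Sum.elim (fun _ => 0) (fun _ => 1) x) = -1} = s := by
  rw [Fintype.card_subtype, Finset.card_filter, Fintype.sum_sum_type]
  simp [paritySign]

theorem ranks_le_of_subset {F : Type u} [Field F] [CharZero F] {r s r' s' : ℕ}
    (h : metabelianSupervariety F r' s' ⊆ metabelianSupervariety F r s) : r' ≤ r ∧ s' ≤ s := by
  have hmem : freeMetabelianSuperalgebra F r' s' ∈ metabelianSupervariety F r s :=
    h fun _ _ _ hf => hf
  constructor
  -- With `k = r + 1` the even generators are too few to fill a block, and `m` exceeds by one the
  -- bound `k * s` on the odd entries, while `r' ≥ k` even generators suffice for nonvanishing.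
  · by_contra! hr
    refine not_satisfiesSuperidentity_rectPolynomial (F := F) (m := (r + 1) * s + 1)
      r' s' 0 r.succ_pos
      (fun j => Sum.inl (Fin.castLE hr j)) (fun a b hab => by simpa using hab) (fun _ => rfl)
      (hmem _ _ (isMultilinear_rectPolynomial _ _ _) ?_)
    apply satisfiesSuperidentity_rectPolynomial
    · exact (card_even_generators r s).trans_lt (Nat.lt_succ_self r)
    · exact (congrArg ((r + 1) * ·) (card_odd_generators r s)).trans_lt (Nat.lt_succ_self _)
  · by_contra! hs
    refine not_satisfiesSuperidentity_rectPolynomial (F := F) (m := (s + 1) * r + 1)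
      r' s' 1 s.succ_pos
      (fun j => Sum.inr (Fin.castLE hs j)) (fun a b hab => by simpa using hab) (fun _ => rfl)
      (hmem _ _ (isMultilinear_rectPolynomial _ _ _) ?_)
    apply satisfiesSuperidentity_rectPolynomial
    · exact (card_odd_generators r s).trans_lt (Nat.lt_succ_self s)
    · exact (congrArg ((s + 1) * ·) (card_even_generators r s)).trans_lt (Nat.lt_succ_self _)

end Superrank

end

theorem mainTheorem8 (F : Type*) [Field F] [CharZero F] (r s r' s' : ℕ) :
    (Superrank.metabelianSupervariety F r' s' ⊆ Superrank.metabelianSupervariety F r s →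
      r' ≤ r ∧ s' ≤ s) ∧
    (Superrank.metabelianSupervariety F r' s' = Superrank.metabelianSupervariety F r s →
      r' = r ∧ s' = s) :=
  ⟨Superrank.ranks_le_of_subset, fun h =>
    ⟨(Superrank.ranks_le_of_subset h.subset).1.antisymm (Superrank.ranks_le_of_subset h.superset).1,
      (Superrank.ranks_le_of_subset h.subset).2.antisymm
        (Superrank.ranks_le_of_subset h.superset).2⟩⟩
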